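/- Conventions. $\mathcal G_n$ is the Pauli group on $n$ qubits; the weight of an element is the number of its non-identity tensor factors. An $[n,k]$ stabiliser code $\mathcal C$ is given by an abelian subgroup $S\subset\mathcal G_n$ with $-I\notin S$ and $n-k$ independent generators; $N(S)$ is its normaliser in $\mathcal G_n$. Global phases are ignored: sets of logical operators are understood to be closed under multiplication by $\pm1,\pm i$. The distance $d$ of $\mathcal C$ is the minimum weight of an element of $N(S)\setminus\{\pm1,\pm i\}S$. Minima over the empty set are $\infty$. Let $A:\mathcal G_k\to N(S)/S$ be an isomorphism and $\overline M\subset\mathcal G_k$ a set containing the identity. Its lift $M\subset N(S)$ is the union of the cosets $A(\overline m)$, $\overline m\in\overline M$, and of their multiples by $\pm1,\pm i$. Put $\tilde d_{\rm eff}=\min_{E\in N(S)\setminus M}\mathrm{weight}(E)$. The code is a quantum error transmuting (QET) code for a set $E$ of physical Pauli errors and the admissible errors $M$ if there is a quantum channel $\mathcal R$ such that for every channel $\mathcal E$ with Kraus operators proportional to elements of $E$ there is a channel $\mathcal M$, preserving the code space, with Kraus operators proportional to elements of $M$, such that $\mathcal R\circ\mathcal E(\rho)=\mathcal M(\rho)$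 for all density operators $\rho$ supported on the code space. The errors $E$ satisfy the transmuting conditions for $M$ if on each coset of $N(S)$ there is a map $\pi$ from the elements of $E$ in the coset to $M$ such that $e^\dagger f=\pi(e)^\dagger\pi(f)$ on the code space, up to phase, for all $e,f\in E$ in the coset. The effective distance $d_{\rm eff}$ for $M$ is $2w+1$, where $w$ is maximal such that the Pauli errors of weight at most $w$ satisfy these conditions ($d_{\rm eff}=\infty$ if all Pauli errors do). Construction. To a Pauli operator $g\propto X^xZ^z$ with $x,z\in\mathbb F_2^n$ assign the $2^n$ vectors $u_{g,t}\in\mathbb F_2^{4n}$, $t\in\mathbb F_2^n$, whose $i$-th block of four entries is $(x_i+t_i,\;t_i,\;z_i+t_i,\;x_i+z_i+t_i)$. (These are the supports of the Majorana monomials that represent $g$ when each qubit is replaced by four Majorana modes $b^x,b^y,b^z,c$ with $b^xb^yb^zc=1$.) The vectors $u_{g,t}$ with $g\in S$ form a self-orthogonal binary linear code $D$, and $\mathrm{CSS}(\mathcal C)$ is the CSS code on $4n$ qubits with stabiliser $S'=\{X^uZ^v:u,v\in D\}$. Let $M_X$ and $M_Z$ be the sets of operators $X^{u_{g,t}}$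 and $Z^{u_{g,t}}$ respectively, with $g\in M$ and $t\in\mathbb F_2^n$, and put $M'=\{\pm1,\pm i\}M_XM_Z$. Theorem. (1) If $\mathcal C$ is an $[n,k]$ stabiliser code of distance $d$, then $\mathrm{CSS}(\mathcal C)$ is a weakly self-dual CSS code (its $X$ and $Z$ parts are given by the same binary code) with parameters $[4n,2k,2d]$. (2) $M'$ is an admissible set for $\mathrm{CSS}(\mathcal C)$: it is the lift, along some isomorphism $\mathcal G_{2k}\cong N(S')/S'$, of a subset of $\mathcal G_{2k}$ that contains the identity. (3) $\min_{F\in N(S')\setminus M'}\mathrm{weight}(F)=2\tilde d_{\rm eff}$. (4) Consequently all Pauli errors of weight at most $\lfloor(2\tilde d_{\rm eff}-1)/2\rfloor$ are transmuted: with $d_{\rm eff}=2w+1$ as above, the effective distance of $\mathrm{CSS}(\mathcal C)$ for $M'$ satisfies $d_{\rm eff}\ge 2\tilde d_{\rm eff}-1$, and for every $w\ge0$ with $2w+1\le2\tilde d_{\rm eff}$ the code $\mathrm{CSS}(\mathcal C)$ is a QET code for the Pauli errors of weight at most $w$ and the admissible errors $M'$. -/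

import Mathlib

open scoped Matrix ComplexOrder

set_option linter.unusedSectionVars false

noncomputable section

namespace QET

/-! ### The Pauli group -/

/-- The additive map `ℤ/2 → ℤ/4`, `a ↦ 2a`, so that `i ^ (dbl a) = (-1) ^ a`. -/
def dbl : ZMod 2 →+ ZMod 4 where
  toFun a := 2 * (a.val : ZMod 4)
  map_zero' := by decide
  map_add' := by decide

/-- An element of the Pauli group on the finite set `ι` of qubits: `⟨p, x, z⟩` stands for the
operator `i ^ p X ^ x Z ^ z`, see `Pauli.toMatrix`. -/
@[ext]
structure Pauli (ι : Type) where
  phase : ZMod 4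
  x : ι → ZMod 2
  z : ι → ZMod 2

namespace Pauli

variable {ι : Type} [Fintype ι]

instance : One (Pauli ι) := ⟨⟨0, 0, 0⟩⟩

/-- `X^x Z^z X^x' Z^z' = (-1)^(z ⬝ x') X^(x + x') Z^(z + z')`. -/
instance : Mul (Pauli ι) :=
  ⟨fun g h => ⟨g.phase + h.phase + dbl (g.z ⬝ᵥ h.x), g.x + h.x, g.z + h.z⟩⟩

instance : Inv (Pauli ι) := ⟨fun g => ⟨-g.phase + dbl (g.z ⬝ᵥ g.x), -g.x, -g.z⟩⟩

@[simp] theorem one_phase : (1 : Pauli ι).phase = 0 := rfl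
@[simp] theorem one_x : (1 : Pauli ι).x = 0 := rfl
@[simp] theorem one_z : (1 : Pauli ι).z = 0 := rfl
@[simp] theorem mul_phase (g h : Pauli ι) :
    (g * h).phase = g.phase + h.phase + dbl (g.z ⬝ᵥ h.x) := rfl
@[simp] theorem mul_x (g h : Pauli ι) : (g * h).x = g.x + h.x := rfl
@[simp] theorem mul_z (g h : Pauli ι) : (g * h).z = g.z + h.z := rfl
@[simp] theorem inv_phase (g : Pauli ι) : g⁻¹.phase = -g.phase + dbl (g.z ⬝ᵥ g.x) := rfl
@[simp] theorem inv_x (g : Pauli ι) : g⁻¹.x = -g.x := rfl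
@[simp] theorem inv_z (g : Pauli ι) : g⁻¹.z = -g.z := rfl

instance : Group (Pauli ι) :=
  Group.ofLeftAxioms
    (by
      intro a b c
      ext1
      · simp only [mul_phase, mul_x, mul_z, add_dotProduct, dotProduct_add, map_add]; ring
      · simp [add_assoc]
      · simp [add_assoc])
    (by intro a; ext1 <;> simp)
    (by
      intro a
      ext1
      · simp only [mul_phase, inv_phase, inv_z, neg_dotProduct, map_neg, one_phase]; ring
      · simp
      · simp)

/-- The global phase `i ^ c` times the identity. -/
def scalar (ι : Type) (c : ZMod 4) : Pauli ι := ⟨c, 0, 0⟩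

/-- The pure `X` operator `X ^ u`. -/
def X (u : ι → ZMod 2) : Pauli ι := ⟨0, u, 0⟩

/-- The pure `Z` operator `Z ^ v`. -/
def Z (v : ι → ZMod 2) : Pauli ι := ⟨0, 0, v⟩

/-- The weight: the number of tensor factors that are not the identity. -/
def weight (g : Pauli ι) : ℕ := (Finset.univ.filter fun i => g.x i ≠ 0 ∨ g.z i ≠ 0).card

/-- The complex number `i ^ p`. -/
def ipow (p : ZMod 4) : ℂ := Complex.I ^ p.val

theorem ipow_add (p q : ZMod 4) : ipow (p + q) = ipow p * ipow q := by
  unfold ipow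
  rw [← pow_add, ZMod.val_add, ← Complex.I_pow_eq_pow_mod]

/-- The operator on `(ℂ²)^{⊗ ι}` (with computational basis `ι → ZMod 2`) denoted by a Pauli
element: `i^p X^x Z^z |a⟩ = i^p (-1)^(z ⬝ a) |a + x⟩`. -/
def toMatrix [DecidableEq ι] (g : Pauli ι) : Matrix (ι → ZMod 2) (ι → ZMod 2) ℂ :=
  Matrix.of fun b a => if b = a + g.x then ipow (g.phase + dbl (g.z ⬝ᵥ a)) else 0

theorem toMatrix_apply [DecidableEq ι] (g : Pauli ι) (b a : ι → ZMod 2) :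
    g.toMatrix b a = if b = a + g.x then ipow (g.phase + dbl (g.z ⬝ᵥ a)) else 0 := rfl

theorem toMatrix_one [DecidableEq ι] : (1 : Pauli ι).toMatrix = 1 := by
  ext b a
  rw [toMatrix_apply, Matrix.one_apply]
  simp [ipow]

theorem toMatrix_mul [DecidableEq ι] (g h : Pauli ι) :
    (g * h).toMatrix = g.toMatrix * h.toMatrix := by
  ext b a
  rw [toMatrix_apply, Matrix.mul_apply, Finset.sum_eq_single (a + h.x)]
  · rw [toMatrix_apply, toMatrix_apply, if_pos rfl]
    have : b = a + (g * h).x ↔ b = a + h.x + g.x := by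
      rw [mul_x, add_assoc, add_comm g.x]
    simp only [this]
    split_ifs
    · rw [← ipow_add]
      congr 1
      simp only [mul_phase, mul_z, add_dotProduct, dotProduct_add, map_add]
      ring
    · simp
  · intro c _ hc
    rw [toMatrix_apply h, if_neg hc, mul_zero]
  · intro h'
    exact absurd (Finset.mem_univ _) h'

theorem ipow_injective : Function.Injective ipow := by
  intro p q h
  have h0 : ∀ r : ZMod 4, ipow r = 1 → r = 0 := by
    intro r hr
    fin_cases r
    · rfl
    · exact absurd hr (by simp [ipow, ZMod.val, Complex.ext_iff])
    · exact absurd hr (by simp [ipow, ZMod.val]; norm_num [Complex.ext_iff])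
    · exact absurd hr (by simp [ipow, ZMod.val, Complex.ext_iff, Complex.I_pow_three])
  have h1 : ipow (p - q) = 1 := by
    have h2 : ipow (p - q) * ipow q = ipow q := by rw [← ipow_add, sub_add_cancel, h]
    have h3 : ipow q ≠ 0 := pow_ne_zero _ Complex.I_ne_zero
    exact mul_right_cancel₀ h3 (by rw [h2, one_mul])
  exact sub_eq_zero.mp (h0 _ h1)

/-- Distinct Pauli elements are distinct operators. -/
theorem toMatrix_injective [DecidableEq ι] : Function.Injective (toMatrix (ι := ι)) := by
  intro g h e
  have ex : ∀ a, g.toMatrix (a + g.x) a = h.toMatrix (a + g.x) a := fun a => by rw [e]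
  have hne : ∀ p, ipow p ≠ 0 := fun p => pow_ne_zero _ Complex.I_ne_zero
  have hx : g.x = h.x := by
    by_contra hc
    have := ex 0
    rw [toMatrix_apply, toMatrix_apply, if_pos rfl, if_neg (by simpa using hc)] at this
    exact hne _ this
  have hph : ∀ a, g.phase + dbl (g.z ⬝ᵥ a) = h.phase + dbl (h.z ⬝ᵥ a) := by
    intro a
    have := ex a
    rw [toMatrix_apply, toMatrix_apply, if_pos rfl, if_pos (by rw [hx])] at this
    exact ipow_injective this
  have hp : g.phase = h.phase := by simpa using hph 0
  have hd : Function.Injective dbl := by decide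
  refine Pauli.ext hp hx (funext fun i => ?_)
  have := hph (Pi.single i 1)
  rw [hp, add_left_cancel_iff] at this
  simpa using hd this

/-- The inverse in the Pauli group is the Hermitian adjoint. -/
theorem toMatrix_inv [DecidableEq ι] (g : Pauli ι) : g⁻¹.toMatrix = g.toMatrixᴴ := by
  have hconj : ∀ p : ZMod 4, star (ipow p) = ipow (-p) := by
    intro p
    have h1 : ipow p * ipow (-p) = 1 := by rw [← ipow_add, add_neg_cancel]; simp [ipow]
    have h2 : ipow p * star (ipow p) = 1 := by
      simp [ipow, ← mul_pow]
    exact mul_left_cancel₀ (pow_ne_zero _ Complex.I_ne_zero) (h2.trans h1.symm)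
  ext b a
  rw [Matrix.conjTranspose_apply, toMatrix_apply, toMatrix_apply]
  have hiff : b = a + g⁻¹.x ↔ a = b + g.x := by
    rw [inv_x, ← sub_eq_add_neg, eq_sub_iff_add_eq, eq_comm]
  simp only [hiff]
  split_ifs with hc
  · rw [hconj]
    congr 1
    subst hc
    have h2 : ∀ c : ZMod 2, dbl c + dbl c = 0 := by decide
    simp only [inv_phase, inv_z, neg_dotProduct, dotProduct_add, map_add, map_neg]
    have := h2 (g.z ⬝ᵥ b)
    ring
  · simp

end Pauli

/-! ### Stabiliser codes -/

/-- A stabiliser code on the qubits `ι`: an abelian subgroup of the Pauli group that does not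
contain `-I`. -/
structure StabilizerCode (ι : Type) [Fintype ι] where
  S : Subgroup (Pauli ι)
  comm : ∀ g ∈ S, ∀ h ∈ S, g * h = h * g
  neg_one_notMem : Pauli.scalar ι 2 ∉ S

namespace StabilizerCode

variable {ι : Type} [Fintype ι] (C : StabilizerCode ι)

/-- `N(S)`, the normaliser of the stabiliser in the Pauli group. -/
abbrev N : Subgroup (Pauli ι) := Subgroup.normalizer (C.S : Set (Pauli ι))

/-- The quotient group `N(S) / S`. -/
abbrev LogicalGroup : Type := C.N ⧸ C.S.subgroupOf C.N

/-- The code encodes `k` logical qubits: the stabiliser has `n - k` independent generators,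
`n` being the number of physical qubits. So `C` is an `[n, k]` code. -/
def EncodesQubits (k : ℕ) : Prop :=
  k ≤ Fintype.card ι ∧ Nat.card C.S = 2 ^ (Fintype.card ι - k)

/-- The code space: the vectors fixed by all stabilisers. -/
def codeSpace [DecidableEq ι] : Submodule ℂ ((ι → ZMod 2) → ℂ) where
  carrier := {ψ | ∀ g ∈ C.S, g.toMatrix *ᵥ ψ = ψ}
  zero_mem' := fun g _ => Matrix.mulVec_zero _
  add_mem' := fun ha hb g hg => by rw [Matrix.mulVec_add, ha g hg, hb g hg]
  smul_mem' := fun c a ha g hg => by rw [Matrix.mulVec_smul, ha g hg]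

/-- The set `{±1, ±i} · S`. -/
def trivialLogicals : Set (Pauli ι) :=
  {g | ∃ (c : ZMod 4) (s : Pauli ι), s ∈ C.S ∧ g = Pauli.scalar ι c * s}

/-- The minimum weight of an element of `N(S) \ M`, which is `⊤` if there is none. -/
def minWeightOutside (M : Set (Pauli ι)) : ℕ∞ :=
  ⨅ g ∈ (C.N : Set (Pauli ι)) \ M, (g.weight : ℕ∞)

/-- The error correcting distance: the minimum weight of an element of `N(S) \ S`, global phases
being ignored. -/
def distance : ℕ∞ := C.minWeightOutside C.trivialLogicals

/-- The lift `M` to `N(S)` of a set `Mbar` of logical Pauli errors along an isomorphism `A` of the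
logical Pauli group on `k` qubits with `N(S) / S`: the union of the cosets `A m`, `m ∈ Mbar`,
global phases being ignored. -/
def lift {k : ℕ} (A : Pauli (Fin k) ≃* C.LogicalGroup) (Mbar : Set (Pauli (Fin k))) :
    Set (Pauli ι) :=
  {g | ∃ m ∈ Mbar, ∃ (c : ZMod 4) (h : C.N),
    (QuotientGroup.mk h : C.LogicalGroup) = A m ∧ g = Pauli.scalar ι c * (h : Pauli ι)}

end StabilizerCode

/-! ### Quantum channels and error transmutation -/

/-- The square matrices acting on the Hilbert space of the qubits `ι`. -/
abbrev Op (ι : Type) : Type := Matrix (ι → ZMod 2) (ι → ZMod 2) ℂ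

variable {ι : Type} [Fintype ι] [DecidableEq ι]

/-- `Φ` is the quantum channel (completely positive trace-preserving map) with the Kraus operators
`K`. -/
def HasKraus {r : ℕ} (K : Fin r → Op ι) (Φ : Op ι → Op ι) : Prop :=
  (∀ ρ, Φ ρ = ∑ a, K a * ρ * (K a)ᴴ) ∧ ∑ a, (K a)ᴴ * K a = 1

/-- `Φ` is a quantum channel. -/
def IsChannel (Φ : Op ι → Op ι) : Prop := ∃ (r : ℕ) (K : Fin r → Op ι), HasKraus K Φ

/-- `Φ` is a quantum channel with Kraus operators proportional to elements of the set `E` of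
Paulis. -/
def IsPauliChannel (E : Set (Pauli ι)) (Φ : Op ι → Op ι) : Prop :=
  ∃ (r : ℕ) (K : Fin r → Op ι), HasKraus K Φ ∧ ∀ a, ∃ e ∈ E, ∃ c : ℂ, K a = c • e.toMatrix

/-- `ρ` is a density operator with support in the code space. -/
def IsCodeState (C : StabilizerCode ι) (ρ : Op ι) : Prop :=
  ρ.PosSemidef ∧ ρ.trace = 1 ∧ ∀ ψ, ρ *ᵥ ψ ∈ C.codeSpace

/-- `Φ` is an admissible logical noise channel for the lifted admissible set `M`. -/
def IsALNC (C : StabilizerCode ι) (M : Set (Pauli ι)) (Φ : Op ι → Op ι) : Prop :=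
  IsPauliChannel M Φ ∧ ∀ ρ, IsCodeState C ρ → IsCodeState C (Φ ρ)

/-- `C` is a quantum error transmuting code for the physical errors `E` and the admissible logical
errors with lift `M`: a single recovery channel turns every noise channel built from `E` into an
admissible logical noise channel on the code space. -/
def IsQETCode (C : StabilizerCode ι) (M E : Set (Pauli ι)) : Prop :=
  ∃ R : Op ι → Op ι, IsChannel R ∧ ∀ Φ, IsPauliChannel E Φ →
    ∃ L, IsALNC C M L ∧ ∀ ρ, IsCodeState C ρ → R (Φ ρ) = L ρ

/-- The error transmuting conditions for physical errors `E` and the lift `M`: on the errors of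
every coset of `N(S)` there is a map `π` to `M` with `e† f = (π e)† (π f)` as linear maps on the
code space, up to a global phase. (The maps on the cosets are collected in one map.) -/
def TransmutingConditions (C : StabilizerCode ι) (M E : Set (Pauli ι)) : Prop :=
  ∃ π : Pauli ι → Pauli ι, (∀ e ∈ E, π e ∈ M) ∧
    ∀ e ∈ E, ∀ f ∈ E, e⁻¹ * f ∈ C.N →
      ∃ c : ZMod 4, ∀ ψ ∈ C.codeSpace,
        (e⁻¹ * f).toMatrix *ᵥ ψ = (Pauli.scalar ι c * ((π e)⁻¹ * π f)).toMatrix *ᵥ ψ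

/-- The Pauli errors of weight at most `w`. -/
def errorsUpTo (ι : Type) [Fintype ι] (w : ℕ) : Set (Pauli ι) := {e | e.weight ≤ w}

/-- The effective distance `2 w + 1`, where `w` is maximal such that the errors of weight at most
`w` satisfy the error transmuting conditions (`⊤` if all errors do). -/
def effectiveDistance (C : StabilizerCode ι) (M : Set (Pauli ι)) : ℕ∞ :=
  ⨆ w ∈ {w : ℕ | TransmutingConditions C M (errorsUpTo ι w)}, (2 * w + 1 : ℕ∞)

/-! ### CSS codes and the Majorana fermion construction -/

/-- The CSS code with stabilisers `X^u Z^v`, `u ∈ D₁`, `v ∈ D₂`, for orthogonal binary linear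
codes. -/
def cssCode (D₁ D₂ : Submodule (ZMod 2) (ι → ZMod 2))
    (h : ∀ u ∈ D₁, ∀ v ∈ D₂, u ⬝ᵥ v = 0) : StabilizerCode ι where
  S :=
    { carrier := {g | g.phase = 0 ∧ g.x ∈ D₁ ∧ g.z ∈ D₂}
      one_mem' := ⟨rfl, D₁.zero_mem, D₂.zero_mem⟩
      mul_mem' := by
        rintro a b ⟨ha, hax, haz⟩ ⟨hb, hbx, hbz⟩
        refine ⟨?_, D₁.add_mem hax hbx, D₂.add_mem haz hbz⟩
        rw [Pauli.mul_phase, ha, hb, dotProduct_comm, h _ hbx _ haz]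
        simp
      inv_mem' := by
        rintro a ⟨ha, hax, haz⟩
        refine ⟨?_, D₁.neg_mem hax, D₂.neg_mem haz⟩
        rw [Pauli.inv_phase, ha, dotProduct_comm, h _ hax _ haz]
        simp }
  comm := by
    rintro a ⟨ha, hax, haz⟩ b ⟨hb, hbx, hbz⟩
    refine Pauli.ext ?_ (add_comm _ _) (add_comm _ _)
    rw [Pauli.mul_phase, Pauli.mul_phase, ha, hb, dotProduct_comm, h _ hbx _ haz,
      dotProduct_comm, h _ hax _ hbz]
  neg_one_notMem := by
    rintro ⟨h0, -, -⟩
    have h1 : (2 : ZMod 4) ≠ 0 := by decide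
    exact h1 h0

/-- `C` is a weakly self-dual CSS code: its `X` part and its `Z` part are given by the same binary
linear code. -/
def IsWeaklySelfDualCSS (C : StabilizerCode ι) : Prop :=
  ∃ (D : Submodule (ZMod 2) (ι → ZMod 2)) (h : ∀ u ∈ D, ∀ v ∈ D, u ⬝ᵥ v = 0), C = cssCode D D h

/-- Replace each qubit by four Majorana modes `bˣ, bʸ, bᶻ, c` (numbered `0, 1, 2, 3`) subject to
`bˣ bʸ bᶻ c = 1`, so that `X ∼ bˣ c ∼ bʸ bᶻ`, `Y ∼ bʸ c ∼ bˣ bᶻ`, `Z ∼ bᶻ c ∼ bˣ bʸ` up to phase.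
The supports of the `2 ^ n` Majorana monomials that represent the Pauli operator `X^x Z^z` are the
vectors `majorana x z t`, where `t` says at which qubits the monomial is multiplied by
`bˣ bʸ bᶻ c`. -/
def majorana (x z t : ι → ZMod 2) : ι × Fin 4 → ZMod 2 :=
  fun q => ![x q.1, 0, z q.1, x q.1 + z q.1] q.2 + t q.1

theorem majorana_add (x z t x' z' t' : ι → ZMod 2) :
    majorana x z t + majorana x' z' t' = majorana (x + x') (z + z') (t + t') := by
  funext ⟨i, j⟩
  fin_cases j <;> simp [majorana] <;> ring

theorem majorana_dotProduct (x z t x' z' t' : ι → ZMod 2) :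
    majorana x z t ⬝ᵥ majorana x' z' t' = x ⬝ᵥ z' + z ⬝ᵥ x' := by
  have key : ∀ a b s a' b' s' : ZMod 2,
      (a + s) * (a' + s') + s * s' + (b + s) * (b' + s') + (a + b + s) * (a' + b' + s')
        = a * b' + b * a' := by decide
  simp only [dotProduct, Fintype.sum_prod_type, ← Finset.sum_add_distrib]
  refine Finset.sum_congr rfl fun i _ => ?_
  rw [← key (x i) (z i) (t i) (x' i) (z' i) (t' i)]
  simp [Fin.sum_univ_four, majorana]

/-- The binary code of all Majorana vectors of stabilisers of `C`. -/
def StabilizerCode.majoranaCode (C : StabilizerCode ι) :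
    Submodule (ZMod 2) (ι × Fin 4 → ZMod 2) where
  carrier := {u | ∃ g ∈ C.S, ∃ t, u = majorana g.x g.z t}
  zero_mem' := ⟨1, C.S.one_mem, 0, by funext ⟨i, j⟩; fin_cases j <;> simp [majorana]⟩
  add_mem' := by
    rintro _ _ ⟨g, hg, t, rfl⟩ ⟨h, hh, s, rfl⟩
    exact ⟨g * h, C.S.mul_mem hg hh, t + s, majorana_add _ _ _ _ _ _⟩
  smul_mem' := by
    rintro c _ ⟨g, hg, t, rfl⟩
    have hc : c = 0 ∨ c = 1 := by revert c; decide
    rcases hc with rfl | rfl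
    · exact ⟨1, C.S.one_mem, 0, by funext ⟨i, j⟩; fin_cases j <;> simp [majorana]⟩
    · exact ⟨g, hg, t, one_smul _ _⟩

theorem StabilizerCode.majoranaCode_orthogonal (C : StabilizerCode ι) :
    ∀ u ∈ C.majoranaCode, ∀ v ∈ C.majoranaCode, u ⬝ᵥ v = 0 := by
  rintro _ ⟨g, hg, t, rfl⟩ _ ⟨h, hh, s, rfl⟩
  rw [majorana_dotProduct]
  have e := congrArg Pauli.phase (C.comm g hg h hh)
  have key : ∀ a b : ZMod 2, dbl a = dbl b → b + a = 0 := by decide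
  rw [Pauli.mul_phase, Pauli.mul_phase, add_comm h.phase, add_left_cancel_iff] at e
  rw [dotProduct_comm g.x h.z]
  exact key _ _ e

/-- `CSS(C)`, on four qubits for each qubit of `C`. -/
def StabilizerCode.toCSS (C : StabilizerCode ι) : StabilizerCode (ι × Fin 4) :=
  cssCode C.majoranaCode C.majoranaCode C.majoranaCode_orthogonal

/-- The pure `X` operators that correspond to elements of `M`. -/
def pureX (M : Set (Pauli ι)) : Set (Pauli (ι × Fin 4)) :=
  {F | ∃ g ∈ M, ∃ t, F = Pauli.X (majorana g.x g.z t)}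

/-- The pure `Z` operators that correspond to elements of `M`. -/
def pureZ (M : Set (Pauli ι)) : Set (Pauli (ι × Fin 4)) :=
  {F | ∃ g ∈ M, ∃ t, F = Pauli.Z (majorana g.x g.z t)}

/-- The set `{±1, ±i} M_X M_Z`. -/
def majoranaErrors (M : Set (Pauli ι)) : Set (Pauli (ι × Fin 4)) :=
  {F | ∃ (c : ZMod 4), ∃ a ∈ pureX M, ∃ b ∈ pureZ M, F = Pauli.scalar _ c * (a * b)}

end QET

end

/-! Everything rests on one identity, `majorana_dotProduct`: the dot product of two Majorana vectors
is the symplectic product of the Pauli elements they represent, whatever the choices of `t`. The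
vectors of the identity span the all-ones vectors of the blocks, and a vector orthogonal to these
has even parity in each block, hence is itself a Majorana vector. So the dual of the code `D`
consists of the Majorana vectors of `N(S)` (`forall_dotProduct_majoranaCode_iff`), and the
normaliser of the CSS stabiliser consists of the phases times `X^u Z^v` with `u`, `v` of this kind.

Such an operator lies outside `M'` exactly when `u` or `v` represents an element of `N(S) \ M`. Each
nontrivial tensor factor of that element contributes two nonzero entries to its vector, and trivial
factors need contribute none. This doubles the minimum weight (`minWeightOutside_majoranaErrors`);
the distance is the case `M = {±1, ±i} S`. The number of logical qubits is a dimension count for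
`D`, and dual bases of `D^⊥ / D` give the logical Pauli group (`exists_logicalGroup_equiv`).

Transmutation holds for any stabiliser code: if `e` and `f` have weight at most `w` and the same
syndrome, then `e⁻¹ f` is in the normaliser with weight at most `2w`, hence admissible once `2w` is
below the minimum weight outside the admissible set. Measuring the syndrome and undoing a fixed
error with that syndrome then leaves an admissible error (`isQETCode_of_inv_mul_mem`). -/

noncomputable section

namespace QET

/-! ### Commutation, phases and weights in the Pauli group -/

namespace Pauli

section

variable {ι : Type} [Fintype ι]

/-- The symplectic form: `g` and `h` commute if it vanishes and anticommute otherwise. -/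
def symp (g h : Pauli ι) : ZMod 2 := g.z ⬝ᵥ h.x + h.z ⬝ᵥ g.x

theorem scalar_mul (c : ZMod 4) (g : Pauli ι) : scalar ι c * g = ⟨c + g.phase, g.x, g.z⟩ := by
  ext1 <;> simp [scalar]

theorem scalar_mul_scalar (c d : ZMod 4) : scalar ι c * scalar ι d = scalar ι (c + d) := by
  rw [scalar_mul]; rfl

theorem scalar_zero : scalar ι 0 = 1 := rfl

theorem scalar_comm (c : ZMod 4) (g : Pauli ι) : scalar ι c * g = g * scalar ι c := by
  ext1 <;> simp [scalar, add_comm]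

theorem mul_eq_scalar_mul (g h : Pauli ι) :
    g * h = scalar ι (dbl (symp g h)) * (h * g) := by
  rw [scalar_mul]
  have key : ∀ a : ZMod 2, dbl a + dbl a = 0 := by decide
  refine Pauli.ext ?_ (add_comm _ _) (add_comm _ _)
  simp only [mul_phase, symp, map_add]
  linear_combination -(key (h.z ⬝ᵥ g.x))

theorem mul_comm_iff {g h : Pauli ι} : g * h = h * g ↔ symp g h = 0 := by
  have hd : Function.Injective dbl := by decide
  rw [mul_eq_scalar_mul, mul_eq_right]
  constructor
  · intro e
    exact hd (congrArg phase e)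
  · intro e
    rw [e, map_zero, scalar_zero]

theorem anticomm_of_not_comm {g h : Pauli ι} (hn : ¬ g * h = h * g) :
    g * h = scalar ι 2 * (h * g) := by
  have key : ∀ a : ZMod 2, a ≠ 0 → dbl a = 2 := by decide
  rw [mul_eq_scalar_mul, key _ (mt mul_comm_iff.2 hn)]

/-- Single-qubit `Z` operators detect the `X` part and single-qubit `X` operators the `Z` part. -/
theorem exists_not_comm {g : Pauli ι} (h : g.x ≠ 0 ∨ g.z ≠ 0) : ∃ f : Pauli ι, ¬ f * g = g * f := by
  classical
  by_contra! hc
  have hc' : ∀ f : Pauli ι, f.z ⬝ᵥ g.x + g.z ⬝ᵥ f.x = 0 := fun f => mul_comm_iff.1 (hc f)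
  rcases h with h | h <;> refine h (funext fun i => ?_)
  · simpa [Z] using hc' (Z (Pi.single i 1))
  · simpa [X] using hc' (X (Pi.single i 1))

theorem weight_inv (g : Pauli ι) : g⁻¹.weight = g.weight := by
  simp [weight]

theorem weight_mul_le (g h : Pauli ι) : (g * h).weight ≤ g.weight + h.weight := by
  classical
  unfold weight
  refine le_trans (Finset.card_le_card ?_) (Finset.card_union_le _ _)
  intro i
  simp only [Finset.mem_filter, Finset.mem_univ, true_and, Finset.mem_union, mul_x, mul_z,
    Pi.add_apply]
  contrapose!
  rintro ⟨⟨h1, h2⟩, h3, h4⟩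
  simp [h1, h2, h3, h4]

/-- A Pauli element is given by its phase and its two parts. -/
def equivProd (ι : Type) : Pauli ι ≃ ZMod 4 × (ι → ZMod 2) × (ι → ZMod 2) where
  toFun g := (g.phase, g.x, g.z)
  invFun p := ⟨p.1, p.2.1, p.2.2⟩
  left_inv _ := rfl
  right_inv _ := rfl

instance : Finite (Pauli ι) := Finite.of_equiv _ (equivProd ι).symm

theorem toMatrix_scalar_mul [DecidableEq ι] (c : ZMod 4) (g : Pauli ι) :
    (scalar ι c * g).toMatrix = ipow c • g.toMatrix := by
  ext b a
  rw [scalar_mul, Matrix.smul_apply, toMatrix_apply, toMatrix_apply]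
  split_ifs
  · rw [add_assoc, ipow_add, smul_eq_mul]
  · simp

theorem ipow_two : ipow 2 = -1 := by
  have : (2 : ZMod 4).val = 2 := rfl
  simp [ipow, this]

end

end Pauli

/-! ### The normaliser, and lifts as unions of cosets -/

namespace StabilizerCode

variable {ι : Type} [Fintype ι] (C : StabilizerCode ι)

/-- The normaliser is the centraliser: Pauli elements commute or anticommute, and if `g` normalises
`S` but anticommutes with `s ∈ S`, then `g s g⁻¹ = -s` puts `-I` in `S`. -/
theorem mem_N {g : Pauli ι} : g ∈ C.N ↔ ∀ s ∈ C.S, g * s = s * g := by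
  rw [Subgroup.mem_normalizer_iff]
  constructor
  · intro h s hs
    by_contra hn
    have h1 : g * s * g⁻¹ ∈ C.S := (h s).1 hs
    rw [Pauli.anticomm_of_not_comm hn, ← mul_assoc, mul_inv_cancel_right] at h1
    exact C.neg_one_notMem ((C.S.mul_mem_cancel_right hs).1 h1)
  · intro h s
    constructor
    · intro hs
      rw [h s hs, mul_inv_cancel_right]
      exact hs
    · intro hs
      have h1 := h _ hs
      rw [inv_mul_cancel_right] at h1
      rwa [mul_left_cancel h1] at hs

theorem le_N : C.S ≤ C.N := fun g hg => C.mem_N.2 fun s hs => C.comm g hg s hs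

theorem scalar_mem_N (c : ZMod 4) : Pauli.scalar ι c ∈ C.N :=
  C.mem_N.2 fun s _ => Pauli.scalar_comm c s

/-- The phases `±i` are excluded because their square is `-1`. -/
theorem eq_zero_of_scalar_mem {c : ZMod 4} (h : Pauli.scalar ι c ∈ C.S) : c = 0 := by
  have key : ∀ c : ZMod 4, c = 0 ∨ c = 2 ∨ c + c = 2 := by decide
  rcases key c with hc | hc | hc
  · exact hc
  · exact absurd (hc ▸ h) C.neg_one_notMem
  · have h2 := C.S.mul_mem h h
    rw [Pauli.scalar_mul_scalar, hc] at h2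
    exact absurd h2 C.neg_one_notMem

/-- Stabilisers are determined by their `X` and `Z` parts. -/
theorem eq_of_x_eq_of_z_eq {g h : Pauli ι} (hg : g ∈ C.S) (hh : h ∈ C.S) (hx : g.x = h.x)
    (hz : g.z = h.z) : g = h := by
  have e : g = Pauli.scalar ι (g.phase - h.phase) * h := by
    rw [Pauli.scalar_mul]
    exact Pauli.ext (by simp) hx hz
  have h1 : Pauli.scalar ι (g.phase - h.phase) ∈ C.S := by
    rw [← C.S.mul_mem_cancel_right hh, ← e]
    exact hg
  rw [e, C.eq_zero_of_scalar_mem h1, Pauli.scalar_zero, one_mul]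

theorem lift_subset_N {k : ℕ} (A : Pauli (Fin k) ≃* C.LogicalGroup) (Mbar : Set (Pauli (Fin k))) :
    C.lift A Mbar ⊆ C.N := by
  rintro _ ⟨m, -, c, h, -, rfl⟩
  exact C.N.mul_mem (C.scalar_mem_N c) h.2

theorem scalar_mul_mem_lift {k : ℕ} {A : Pauli (Fin k) ≃* C.LogicalGroup}
    {Mbar : Set (Pauli (Fin k))} {g : Pauli ι} (hg : g ∈ C.lift A Mbar) (c : ZMod 4) :
    Pauli.scalar ι c * g ∈ C.lift A Mbar := by
  obtain ⟨m, hm, d, h, e, rfl⟩ := hg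
  exact ⟨m, hm, c + d, h, e, by rw [← mul_assoc, Pauli.scalar_mul_scalar]⟩

theorem mul_mem_lift {k : ℕ} {A : Pauli (Fin k) ≃* C.LogicalGroup}
    {Mbar : Set (Pauli (Fin k))} {g s : Pauli ι} (hg : g ∈ C.lift A Mbar) (hs : s ∈ C.S) :
    g * s ∈ C.lift A Mbar := by
  obtain ⟨m, hm, d, h, e, rfl⟩ := hg
  have hs' : (⟨s, C.le_N hs⟩ : C.N) ∈ C.S.subgroupOf C.N := Subgroup.mem_subgroupOf.2 hs
  refine ⟨m, hm, d, h * ⟨s, C.le_N hs⟩, ?_, ?_⟩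
  · rw [← e]
    exact QuotientGroup.mk_mul_of_mem h hs'
  · rw [Subgroup.coe_mul, mul_assoc]

theorem one_mem_lift {k : ℕ} {A : Pauli (Fin k) ≃* C.LogicalGroup}
    {Mbar : Set (Pauli (Fin k))} (hM : 1 ∈ Mbar) : 1 ∈ C.lift A Mbar := by
  refine ⟨1, hM, 0, 1, ?_, ?_⟩
  · rw [map_one]
    exact QuotientGroup.mk_one _
  · rw [Pauli.scalar_zero, one_mul, Subgroup.coe_one]

/-- A set of normalising elements that is closed under multiplication by phases and stabilisers is
the lift of a set of logical operators. -/
theorem exists_lift_eq {k : ℕ} (A : Pauli (Fin k) ≃* C.LogicalGroup) (M : Set (Pauli ι))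
    (hN : M ⊆ C.N) (h1 : 1 ∈ M) (hc : ∀ g ∈ M, ∀ c, Pauli.scalar ι c * g ∈ M)
    (hS : ∀ g ∈ M, ∀ s ∈ C.S, g * s ∈ M) :
    ∃ Mbar : Set (Pauli (Fin k)), 1 ∈ Mbar ∧ C.lift A Mbar = M := by
  -- Take the `m` whose coset `A m` meets `M`; closure under `S` makes such a coset lie in `M`.
  refine ⟨{m | ∃ h : C.N, (QuotientGroup.mk h : C.LogicalGroup) = A m ∧ (h : Pauli ι) ∈ M},
    ⟨1, ?_, by rwa [Subgroup.coe_one]⟩, ?_⟩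
  · rw [map_one]
    exact QuotientGroup.mk_one _
  ext g
  constructor
  · rintro ⟨m, ⟨h', e', hM⟩, c, h, e, rfl⟩
    refine hc _ ?_ c
    have e2 := QuotientGroup.eq.1 (e'.trans e.symm)
    have := hS _ hM _ (Subgroup.mem_subgroupOf.1 e2)
    simpa using this
  · intro hg
    exact ⟨A.symm (QuotientGroup.mk (⟨g, hN hg⟩ : C.N)), ⟨⟨g, hN hg⟩, by simp, hg⟩, 0, ⟨g, hN hg⟩,
      by simp, by rw [Pauli.scalar_zero, one_mul]⟩

end StabilizerCode

/-! ### The code projector and its translates by errors -/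

section

variable {ι : Type} [Fintype ι] [DecidableEq ι]

theorem eq_zero_of_eq_neg {A : Op ι} (h : A = -A) : A = 0 := by
  ext i j
  exact self_eq_neg.1 (congrFun (congrFun h i) j)

instance : Fintype (Pauli ι) := Fintype.ofFinite _

namespace StabilizerCode

variable (C : StabilizerCode ι)

instance : Fintype C.S := Fintype.ofFinite _

instance : Fintype (Pauli ι ⧸ C.N) := Fintype.ofFinite _

/-- The projector onto the code space: the average of the stabilisers. -/
def proj : Op ι := (Fintype.card C.S : ℂ)⁻¹ • ∑ s : C.S, (s : Pauli ι).toMatrix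

theorem toMatrix_mul_proj {s : Pauli ι} (hs : s ∈ C.S) : s.toMatrix * C.proj = C.proj := by
  rw [proj, Matrix.mul_smul, Finset.mul_sum]
  congr 1
  refine Fintype.sum_equiv (Equiv.mulLeft ⟨s, hs⟩) _ _ fun t => ?_
  rw [← Pauli.toMatrix_mul]
  rfl

theorem proj_mul_toMatrix {s : Pauli ι} (hs : s ∈ C.S) : C.proj * s.toMatrix = C.proj := by
  rw [proj, Matrix.smul_mul, Finset.sum_mul]
  congr 1
  refine Fintype.sum_equiv (Equiv.mulRight ⟨s, hs⟩) _ _ fun t => ?_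
  rw [← Pauli.toMatrix_mul]
  rfl

theorem proj_mul_of_fixed {ρ : Op ι} (h : ∀ s ∈ C.S, s.toMatrix * ρ = ρ) : C.proj * ρ = ρ := by
  rw [proj, Matrix.smul_mul, Finset.sum_mul, Finset.sum_congr rfl fun (s : C.S) _ => h s s.2,
    Finset.sum_const, Finset.card_univ, ← Nat.cast_smul_eq_nsmul ℂ, smul_smul, inv_mul_cancel₀,
    one_smul]
  exact Nat.cast_ne_zero.2 Fintype.card_ne_zero

theorem proj_mul_proj : C.proj * C.proj = C.proj :=
  C.proj_mul_of_fixed fun _ => C.toMatrix_mul_proj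

theorem conjTranspose_proj : C.projᴴ = C.proj := by
  rw [proj, Matrix.conjTranspose_smul, Matrix.conjTranspose_sum]
  congr 1
  · simp
  · refine Fintype.sum_equiv (Equiv.inv C.S) _ _ fun t => ?_
    rw [← Pauli.toMatrix_inv]
    rfl

theorem toMatrix_mul_proj_comm {g : Pauli ι} (hg : g ∈ C.N) :
    g.toMatrix * C.proj = C.proj * g.toMatrix := by
  rw [proj, Matrix.smul_mul, Finset.sum_mul, Matrix.mul_smul, Finset.mul_sum]
  congr 1
  refine Finset.sum_congr rfl fun s _ => ?_
  rw [← Pauli.toMatrix_mul, C.mem_N.1 hg s s.2, Pauli.toMatrix_mul]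

/-- Some stabiliser anticommutes with `g`. The projector absorbs it on either side, so the product
equals its own negative. This makes different syndromes orthogonal. -/
theorem proj_mul_toMatrix_mul_proj {g : Pauli ι} (hg : g ∉ C.N) :
    C.proj * g.toMatrix * C.proj = 0 := by
  rw [mem_N] at hg
  push Not at hg
  obtain ⟨s, hs, hn⟩ := hg
  have e : g.toMatrix * s.toMatrix = - (s.toMatrix * g.toMatrix) := by
    rw [← Pauli.toMatrix_mul, Pauli.anticomm_of_not_comm hn, Pauli.toMatrix_scalar_mul,
      Pauli.ipow_two, neg_one_smul, Pauli.toMatrix_mul]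
  have h : C.proj * g.toMatrix * C.proj = -(C.proj * g.toMatrix * C.proj) := by
    calc C.proj * g.toMatrix * C.proj
        = C.proj * (g.toMatrix * s.toMatrix) * C.proj := by
          rw [Matrix.mul_assoc, Matrix.mul_assoc, Matrix.mul_assoc, C.toMatrix_mul_proj hs]
      _ = -((C.proj * s.toMatrix) * g.toMatrix * C.proj) := by
          rw [e]; simp only [Matrix.mul_neg, Matrix.neg_mul, Matrix.mul_assoc]
      _ = _ := by rw [C.proj_mul_toMatrix hs]
  exact eq_zero_of_eq_neg h

/-- The projector onto the code space translated by `g`. -/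
def errorProj (g : Pauli ι) : Op ι := g.toMatrix * C.proj * g⁻¹.toMatrix

/-- Elements of `N(S)` commute with the projector, so a translate depends only on the coset, that
is, on the syndrome. -/
theorem errorProj_mul_of_mem (g : Pauli ι) {h : Pauli ι} (hh : h ∈ C.N) :
    C.errorProj (g * h) = C.errorProj g := by
  rw [errorProj, errorProj, mul_inv_rev, Pauli.toMatrix_mul, Pauli.toMatrix_mul,
    Matrix.mul_assoc g.toMatrix, C.toMatrix_mul_proj_comm hh]
  simp only [Matrix.mul_assoc]
  rw [← Matrix.mul_assoc h.toMatrix, ← Pauli.toMatrix_mul, mul_inv_cancel, Pauli.toMatrix_one,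
    Matrix.one_mul]

theorem toMatrix_mul_errorProj (f g : Pauli ι) :
    f.toMatrix * C.errorProj g * f⁻¹.toMatrix = C.errorProj (f * g) := by
  rw [errorProj, errorProj, mul_inv_rev, Pauli.toMatrix_mul, Pauli.toMatrix_mul]
  simp only [Matrix.mul_assoc]

theorem errorProj_mul_errorProj (f g : Pauli ι) :
    C.errorProj f * C.errorProj g =
      f.toMatrix * (C.proj * (f⁻¹ * g).toMatrix * C.proj) * g⁻¹.toMatrix := by
  rw [errorProj, errorProj, Pauli.toMatrix_mul]
  simp only [Matrix.mul_assoc]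

open Classical in
/-- A choice of representatives of the cosets of `N(S)` that lie in `E` if possible. -/
def cosetRep (E : Set (Pauli ι)) (c : Pauli ι ⧸ C.N) : Pauli ι :=
  if h : ∃ e ∈ E, (QuotientGroup.mk e : Pauli ι ⧸ C.N) = c then h.choose else c.out

theorem mk_cosetRep (E : Set (Pauli ι)) (c : Pauli ι ⧸ C.N) :
    (QuotientGroup.mk (C.cosetRep E c) : Pauli ι ⧸ C.N) = c := by
  unfold cosetRep
  split_ifs with h
  · exact h.choose_spec.2
  · exact QuotientGroup.out_eq' c

theorem cosetRep_mem {E : Set (Pauli ι)} {e : Pauli ι} (he : e ∈ E) :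
    C.cosetRep E (QuotientGroup.mk e) ∈ E := by
  have h : ∃ f ∈ E, (QuotientGroup.mk f : Pauli ι ⧸ C.N) = QuotientGroup.mk e := ⟨e, he, rfl⟩
  rw [cosetRep, dif_pos h]
  exact h.choose_spec.1

theorem cosetRep_inv_mul_mem_N (E : Set (Pauli ι)) (e : Pauli ι) :
    (C.cosetRep E (QuotientGroup.mk e))⁻¹ * e ∈ C.N :=
  QuotientGroup.eq.1 (C.mk_cosetRep E _)

/-- Reindexing by `f ↦ f h`, with `h` anticommuting with `s`, changes the sign of the sum. -/
theorem sum_conj_eq_zero {s : Pauli ι} (hs : s.x ≠ 0 ∨ s.z ≠ 0) :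
    ∑ f : Pauli ι, (f * s * f⁻¹).toMatrix = 0 := by
  obtain ⟨h, hh⟩ := Pauli.exists_not_comm hs
  refine eq_zero_of_eq_neg ?_
  rw [← Finset.sum_neg_distrib]
  refine (Fintype.sum_equiv (Equiv.mulRight h) _ _ fun f => ?_).symm
  have e : f * h * s * (f * h)⁻¹ = Pauli.scalar ι 2 * (f * s * f⁻¹) := by
    have := Pauli.anticomm_of_not_comm hh
    rw [mul_assoc f h s, this, ← mul_assoc f, ← Pauli.scalar_comm]
    group
  rw [Equiv.coe_mulRight, e, Pauli.toMatrix_scalar_mul, Pauli.ipow_two, neg_one_smul]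

/-- Expand the projector as an average over `S`: only the identity survives the sum over conjugates,
since no other stabiliser is a pure phase. -/
theorem sum_univ_errorProj :
    ∑ f : Pauli ι, C.errorProj f
      = ((Fintype.card C.S : ℂ)⁻¹ * Fintype.card (Pauli ι)) • (1 : Op ι) := by
  have e : ∀ f, C.errorProj f
      = (Fintype.card C.S : ℂ)⁻¹ • ∑ s : C.S, (f * s * f⁻¹).toMatrix := by
    intro f
    rw [errorProj, proj, Matrix.mul_smul, Matrix.smul_mul, Finset.mul_sum, Finset.sum_mul]
    simp only [Pauli.toMatrix_mul]
  rw [Finset.sum_congr rfl fun f _ => e f, ← Finset.smul_sum, Finset.sum_comm, mul_smul]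
  congr 1
  rw [Finset.sum_eq_single 1]
  · simp only [Subgroup.coe_one, mul_one, mul_inv_cancel, Pauli.toMatrix_one, Finset.sum_const,
      Finset.card_univ, ← Nat.cast_smul_eq_nsmul ℂ]
  · intro s _ hs
    refine sum_conj_eq_zero ?_
    by_contra! h
    exact hs (Subtype.ext (C.eq_of_x_eq_of_z_eq s.2 C.S.one_mem h.1 h.2))
  · intro h
    exact absurd (Finset.mem_univ _) h

/-- The translated projectors resolve the identity. -/
theorem sum_errorProj (r : Pauli ι ⧸ C.N → Pauli ι)
    (hr : ∀ c, (QuotientGroup.mk (r c) : Pauli ι ⧸ C.N) = c) :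
    ∑ c, C.errorProj (r c) = 1 := by
  set Q := ∑ c, C.errorProj (r c) with hQ
  -- Conjugation by `f` permutes the cosets of `N(S)`, hence the summands of `Q`.
  have hcomm : ∀ f : Pauli ι, f.toMatrix * Q * f⁻¹.toMatrix = Q := by
    intro f
    rw [hQ, Finset.mul_sum, Finset.sum_mul]
    refine Fintype.sum_equiv (MulAction.toPerm f) _ _ fun c => ?_
    rw [toMatrix_mul_errorProj]
    have h1 : (QuotientGroup.mk (f * r c) : Pauli ι ⧸ C.N)
        = QuotientGroup.mk (r (MulAction.toPerm f c)) := by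
      rw [hr]
      conv_rhs => rw [← hr c]
      rfl
    have h2 := C.errorProj_mul_of_mem (f * r c) (QuotientGroup.eq.1 h1)
    rw [mul_inv_cancel_left] at h2
    exact h2.symm
  have hG : (Fintype.card (Pauli ι) : ℂ) ≠ 0 := Nat.cast_ne_zero.2 Fintype.card_ne_zero
  have hS : (Fintype.card C.S : ℂ) ≠ 0 := Nat.cast_ne_zero.2 Fintype.card_ne_zero
  have hT : (Fintype.card (Pauli ι ⧸ C.N) : ℂ) ≠ 0 := Nat.cast_ne_zero.2 Fintype.card_ne_zero
  -- Averaging `Q` over all conjugations shows that it is a scalar, namely the number of cosets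
  -- divided by the order of `S`. Only `l ≠ 0` is needed, as idempotency then forces `l = 1`.
  obtain ⟨l, hl0, hl⟩ : ∃ l : ℂ, l ≠ 0 ∧ Q = l • (1 : Op ι) := by
    refine ⟨(Fintype.card (Pauli ι) : ℂ)⁻¹ * (Fintype.card (Pauli ι ⧸ C.N) *
      ((Fintype.card C.S : ℂ)⁻¹ * Fintype.card (Pauli ι))),
      mul_ne_zero (inv_ne_zero hG) (mul_ne_zero hT (mul_ne_zero (inv_ne_zero hS) hG)), ?_⟩
    have h1 : (Fintype.card (Pauli ι) : ℂ) • Q = ∑ f : Pauli ι, f.toMatrix * Q * f⁻¹.toMatrix := by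
      rw [Finset.sum_congr rfl fun f _ => hcomm f, Finset.sum_const, Finset.card_univ,
        ← Nat.cast_smul_eq_nsmul ℂ]
    rw [mul_smul, mul_smul, ← sum_univ_errorProj, eq_inv_smul_iff₀ hG, h1]
    simp only [hQ, Finset.mul_sum, Finset.sum_mul, toMatrix_mul_errorProj]
    rw [Finset.sum_comm, Nat.cast_smul_eq_nsmul, ← Finset.card_univ, ← Finset.sum_const]
    refine Finset.sum_congr rfl fun c _ => ?_
    exact Fintype.sum_equiv (Equiv.mulRight (r c)) _ _ fun f => rfl
  have hQQ : Q * Q = Q := by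
    conv_rhs => rw [hQ]
    rw [hQ, Finset.sum_mul]
    refine Finset.sum_congr rfl fun c _ => ?_
    rw [Finset.mul_sum, Finset.sum_eq_single c]
    · rw [errorProj_mul_errorProj, inv_mul_cancel, Pauli.toMatrix_one, Matrix.mul_one,
        proj_mul_proj, errorProj]
    · intro d _ hd
      rw [errorProj_mul_errorProj, proj_mul_toMatrix_mul_proj, Matrix.mul_zero, Matrix.zero_mul]
      intro hm
      have := QuotientGroup.eq.2 hm
      rw [hr, hr] at this
      exact hd this.symm
    · intro h
      exact absurd (Finset.mem_univ _) h
  rw [hl, Matrix.smul_mul, Matrix.one_mul] at hQQ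
  have h1 : (1 : Op ι) ≠ 0 := one_ne_zero
  have h2 := smul_right_injective (Op ι) hl0 hQQ
  rw [hl]
  exact h2

end StabilizerCode

end

/-! ### Logical Pauli groups of weakly self-dual CSS codes -/

section

variable {ι : Type} [Fintype ι] [DecidableEq ι]

/-- For a self-orthogonal binary code `D`, the quotient `D^⊥ / D` has a basis and a dual basis. -/
theorem exists_dual_frames (D : Submodule (ZMod 2) (ι → ZMod 2))
    (hD : ∀ u ∈ D, ∀ v ∈ D, u ⬝ᵥ v = 0) (m : ℕ)
    (hm : 2 * Module.finrank (ZMod 2) D + m = Fintype.card ι) :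
    ∃ α β : (Fin m → ZMod 2) →ₗ[ZMod 2] (ι → ZMod 2),
      (∀ a, ∀ u ∈ D, α a ⬝ᵥ u = 0) ∧ (∀ b, ∀ u ∈ D, β b ⬝ᵥ u = 0) ∧
      (∀ a b, β b ⬝ᵥ α a = b ⬝ᵥ a) ∧
      (∀ v, (∀ u ∈ D, v ⬝ᵥ u = 0) → ∃ a, v - α a ∈ D) ∧
      (∀ v, (∀ u ∈ D, v ⬝ᵥ u = 0) → ∃ b, v - β b ∈ D) := by
  let B : LinearMap.BilinForm (ZMod 2) (ι → ZMod 2) := dotProductBilin (ZMod 2) (ZMod 2)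
  have hB : ∀ u v, B u v = u ⬝ᵥ v := fun _ _ => rfl
  have hsymm : B.IsSymm := ⟨fun u v => dotProduct_comm _ _⟩
  have hnd : B.Nondegenerate := by
    refine ⟨fun u hu => funext fun i => ?_, fun u hu => funext fun i => ?_⟩
    · simpa [hB] using hu (Pi.single i 1)
    · simpa [hB] using hu (Pi.single i 1)
  have hmem : ∀ v, v ∈ B.orthogonal D ↔ ∀ u ∈ D, v ⬝ᵥ u = 0 := by
    intro v
    rw [LinearMap.BilinForm.mem_orthogonal_iff]
    exact forall₂_congr fun u _ => by rw [hB, dotProduct_comm]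
  have hle : D ≤ B.orthogonal D := fun v hv => (hmem v).2 fun u hu => hD v hv u hu
  -- A complement `W` of `D` in `D^⊥` models the quotient. The form on it may be alternating, so an
  -- orthonormal basis need not exist; a basis and its dual basis are used instead.
  obtain ⟨W, hdisj, hsup⟩ := IsModularLattice.exists_disjoint_and_sup_eq hle
  have hWle : W ≤ B.orthogonal D := hsup ▸ le_sup_right
  have hrank : Module.finrank (ZMod 2) W = m := by
    have h1 := Submodule.finrank_sup_add_finrank_inf_eq D W
    rw [hdisj.eq_bot, hsup, finrank_bot, LinearMap.BilinForm.finrank_orthogonal hnd,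
      Module.finrank_fintype_fun_eq_card] at h1
    omega
  -- A vector of `W` orthogonal to `W` is orthogonal to `D + W = D^⊥`, so it lies in `D^⊥⊥ = D` and
  -- vanishes.
  have hWsep : ∀ w : W, (∀ w' : W, (w : ι → ZMod 2) ⬝ᵥ (w' : ι → ZMod 2) = 0) → w = 0 := by
    intro w hw
    have h1 : (w : ι → ZMod 2) ∈ B.orthogonal (B.orthogonal D) := by
      rw [LinearMap.BilinForm.mem_orthogonal_iff]
      intro v hv
      rw [← hsup] at hv
      obtain ⟨d, hd, w', hw', rfl⟩ := Submodule.mem_sup.1 hv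
      rw [hB, dotProduct_comm, dotProduct_add,
        hw ⟨w', hw'⟩, (hmem w).1 (hWle w.2) d hd, add_zero]
    rw [LinearMap.BilinForm.orthogonal_orthogonal hnd hsymm.isRefl] at h1
    exact Subtype.ext (Submodule.disjoint_def.1 hdisj _ h1 w.2)
  have hBW : (B.restrict W).Nondegenerate := by
    refine ⟨fun w hw => hWsep w fun w' => hw w', fun w hw => hWsep w fun w' => ?_⟩
    rw [dotProduct_comm]
    exact hw w'
  let b : Module.Basis (Fin m) (ZMod 2) W := Module.finBasisOfFinrankEq _ _ hrank
  let b' := (B.restrict W).dualBasis hBW b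
  have hdual : ∀ i j, (b' i : ι → ZMod 2) ⬝ᵥ (b j : ι → ZMod 2) = if j = i then 1 else 0 :=
    fun i j => LinearMap.BilinForm.apply_dualBasis_left hBW b i j
  have hspan : ∀ (e : Module.Basis (Fin m) (ZMod 2) W) (v : ι → ZMod 2),
      (∀ u ∈ D, v ⬝ᵥ u = 0) → ∃ a, v - (W.subtype ∘ₗ e.equivFun.symm.toLinearMap) a ∈ D := by
    intro e v hv
    rw [← hmem, ← hsup] at hv
    obtain ⟨d, hd, w, hw, rfl⟩ := Submodule.mem_sup.1 hv
    exact ⟨e.equivFun ⟨w, hw⟩, by simpa using hd⟩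
  refine ⟨W.subtype ∘ₗ b.equivFun.symm.toLinearMap, W.subtype ∘ₗ b'.equivFun.symm.toLinearMap,
    fun a => (hmem _).1 (hWle (Subtype.mem _)), fun a => (hmem _).1 (hWle (Subtype.mem _)),
    fun x y => ?_, hspan b, hspan b'⟩
  simp only [LinearMap.comp_apply, LinearEquiv.coe_coe, Module.Basis.equivFun_symm_apply,
    Submodule.subtype_apply, Submodule.coe_sum, Submodule.coe_smul, sum_dotProduct, dotProduct_sum,
    smul_dotProduct, dotProduct_smul, hdual]
  simp [dotProduct, mul_comm]

theorem mem_cssCode_N (D : Submodule (ZMod 2) (ι → ZMod 2))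
    (hD : ∀ u ∈ D, ∀ v ∈ D, u ⬝ᵥ v = 0) {g : Pauli ι} :
    g ∈ (cssCode D D hD).N ↔ (∀ u ∈ D, g.x ⬝ᵥ u = 0) ∧ ∀ u ∈ D, g.z ⬝ᵥ u = 0 := by
  rw [StabilizerCode.mem_N]
  constructor
  · intro h
    refine ⟨fun u hu => ?_, fun u hu => ?_⟩
    · have := Pauli.mul_comm_iff.1 (h (Pauli.Z u) ⟨rfl, D.zero_mem, hu⟩)
      rw [dotProduct_comm]
      simpa [Pauli.symp, Pauli.Z] using this
    · have := Pauli.mul_comm_iff.1 (h (Pauli.X u) ⟨rfl, hu, D.zero_mem⟩)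
      simpa [Pauli.symp, Pauli.X] using this
  · rintro ⟨hx, hz⟩ s ⟨-, hsx, hsz⟩
    rw [Pauli.mul_comm_iff, Pauli.symp, hz _ hsx, dotProduct_comm, hx _ hsz, add_zero]

/-- The logical Pauli group of a weakly self-dual CSS code is a Pauli group. -/
theorem exists_logicalGroup_equiv (D : Submodule (ZMod 2) (ι → ZMod 2))
    (hD : ∀ u ∈ D, ∀ v ∈ D, u ⬝ᵥ v = 0) (m : ℕ)
    (hm : 2 * Module.finrank (ZMod 2) D + m = Fintype.card ι) :
    Nonempty (Pauli (Fin m) ≃* (cssCode D D hD).LogicalGroup) := by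
  obtain ⟨α, β, hα, hβ, hαβ, hsα, hsβ⟩ := exists_dual_frames D hD m hm
  -- Sending `X` parts through `α` and `Z` parts through `β` keeps the pairing in the multiplication
  -- law, so phases are multiplicative without correction.
  let ψ : Pauli (Fin m) →* (cssCode D D hD).N :=
    { toFun := fun g => ⟨⟨g.phase, α g.x, β g.z⟩, (mem_cssCode_N D hD).2 ⟨hα _, hβ _⟩⟩
      map_one' := Subtype.ext (Pauli.ext rfl (map_zero α) (map_zero β))
      map_mul' := fun g h => Subtype.ext (Pauli.ext
        (by simp [hαβ]) (map_add α _ _) (map_add β _ _)) }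
  refine ⟨MulEquiv.ofBijective ((QuotientGroup.mk' _).comp ψ) ⟨?_, ?_⟩⟩
  · rw [injective_iff_map_eq_one]
    intro g hg
    have hg' : ((ψ g : (cssCode D D hD).N) : Pauli ι) ∈ (cssCode D D hD).S :=
      Subgroup.mem_subgroupOf.1 ((QuotientGroup.eq_one_iff _).1 hg)
    obtain ⟨hp, hx : α g.x ∈ D, hz : β g.z ∈ D⟩ := hg'
    refine Pauli.ext hp (funext fun i => ?_) (funext fun i => ?_)
    -- If `α g.x` lies in `D`, it is orthogonal to every `β b`, so `g.x` is orthogonal to every unit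
    -- vector.
    · have := hαβ g.x (Pi.single i 1)
      rw [hβ _ _ hx] at this
      simpa using this.symm
    · have := hαβ (Pi.single i 1) g.z
      rw [dotProduct_comm, hα _ _ hz] at this
      simpa using this.symm
  · intro q
    obtain ⟨⟨g, hg⟩, rfl⟩ := QuotientGroup.mk_surjective q
    obtain ⟨hx, hz⟩ := (mem_cssCode_N D hD).1 hg
    obtain ⟨a, ha⟩ := hsα _ hx
    obtain ⟨b, hb⟩ := hsβ _ hz
    refine ⟨⟨g.phase, a, b⟩, ?_⟩
    have hs : (⟨0, g.x - α a, g.z - β b⟩ : Pauli ι) ∈ (cssCode D D hD).S := ⟨rfl, ha, hb⟩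
    have e : (⟨g, hg⟩ : (cssCode D D hD).N) =
        ψ ⟨g.phase, a, b⟩ * ⟨_, (cssCode D D hD).le_N hs⟩ := by
      refine Subtype.ext (Pauli.ext ?_ ?_ ?_)
      · simp [ψ, hβ _ _ ha]
      · simp [ψ]
      · simp [ψ]
    rw [e]
    exact (QuotientGroup.mk_mul_of_mem _ (Subgroup.mem_subgroupOf.2 hs)).symm

end

/-! ### Error transmutation by syndrome measurement -/

section

variable {ι : Type} [Fintype ι] [DecidableEq ι]

theorem isChannel_of_kraus {κ : Type} [Fintype κ] (K : κ → Op ι)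
    (hK : ∑ a, (K a)ᴴ * K a = 1) : IsChannel fun ρ => ∑ a, K a * ρ * (K a)ᴴ :=
  ⟨Fintype.card κ, fun i => K ((Fintype.equivFin κ).symm i),
    fun ρ => (Equiv.sum_comp (Fintype.equivFin κ).symm fun a => K a * ρ * (K a)ᴴ).symm,
    (Equiv.sum_comp (Fintype.equivFin κ).symm fun a => (K a)ᴴ * K a).trans hK⟩

theorem conjTranspose_mul_self_smul_toMatrix (c : ℂ) (g : Pauli ι) :
    (c • g.toMatrix)ᴴ * (c • g.toMatrix) = (star c * c) • (1 : Op ι) := by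
  rw [Matrix.conjTranspose_smul, Matrix.smul_mul, Matrix.mul_smul, smul_smul,
    ← Pauli.toMatrix_inv, ← Pauli.toMatrix_mul, inv_mul_cancel, Pauli.toMatrix_one]

namespace IsCodeState

variable {C : StabilizerCode ι} {ρ : Op ι}

theorem toMatrix_mul (h : IsCodeState C ρ) {s : Pauli ι} (hs : s ∈ C.S) :
    s.toMatrix * ρ = ρ := by
  refine Matrix.ext_of_mulVec_single fun i => ?_
  rw [← Matrix.mulVec_mulVec]
  exact h.2.2 _ s hs

theorem eq_proj_mul_mul_proj (h : IsCodeState C ρ) : ρ = C.proj * ρ * C.proj := by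
  have h1 : C.proj * ρ = ρ := C.proj_mul_of_fixed fun s hs => h.toMatrix_mul hs
  have h2 := congrArg Matrix.conjTranspose h1
  rw [Matrix.conjTranspose_mul, C.conjTranspose_proj, h.1.isHermitian.eq] at h2
  rw [h1, h2]

theorem sum_kraus {κ : Type} [Fintype κ] (h : IsCodeState C ρ) (c : κ → ℂ) (f : κ → Pauli ι)
    (hf : ∀ a, f a ∈ C.N)
    (hK : ∑ a, (c a • (f a).toMatrix)ᴴ * (c a • (f a).toMatrix) = 1) :
    IsCodeState C (∑ a, (c a • (f a).toMatrix) * ρ * (c a • (f a).toMatrix)ᴴ) := by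
  refine ⟨Matrix.posSemidef_sum _ fun a _ => h.1.mul_mul_conjTranspose_same _, ?_, ?_⟩
  · rw [Matrix.trace_sum, Finset.sum_congr rfl fun a _ => Matrix.trace_mul_cycle _ ρ _,
      ← Matrix.trace_sum, ← Finset.sum_mul, hK, Matrix.one_mul, h.2.1]
  · intro ψ s hs
    have e : ∀ a, s.toMatrix * (c a • (f a).toMatrix * ρ * (c a • (f a).toMatrix)ᴴ)
        = c a • (f a).toMatrix * ρ * (c a • (f a).toMatrix)ᴴ := by
      intro a
      have e : s.toMatrix * (c a • (f a).toMatrix) = (c a • (f a).toMatrix) * s.toMatrix := by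
        rw [Matrix.mul_smul, Matrix.smul_mul, ← Pauli.toMatrix_mul, ← C.mem_N.1 (hf a) s hs,
          Pauli.toMatrix_mul]
      rw [← Matrix.mul_assoc, ← Matrix.mul_assoc, e, Matrix.mul_assoc _ s.toMatrix,
        h.toMatrix_mul hs]
    rw [Matrix.mulVec_mulVec, Finset.mul_sum, Finset.sum_congr rfl fun a _ => e a]

end IsCodeState

/-- Measuring the syndrome and undoing some error with that syndrome transmutes the errors `E`
if products of errors with the same syndrome are admissible. -/
theorem isQETCode_of_inv_mul_mem (C : StabilizerCode ι) {M E : Set (Pauli ι)}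
    (h : ∀ e ∈ E, ∀ f ∈ E, e⁻¹ * f ∈ C.N → e⁻¹ * f ∈ M) : IsQETCode C M E := by
  classical
  -- With `r` the representative of `q` and `P` the code projector, `P r⁻¹ = r⁻¹ (r P r⁻¹)`: detect
  -- the syndrome `q`, then undo `r`.
  let K : Pauli ι ⧸ C.N → Op ι := fun q => C.proj * (C.cosetRep E q)⁻¹.toMatrix
  have hK : ∑ q, (K q)ᴴ * K q = 1 := by
    rw [← C.sum_errorProj _ (C.mk_cosetRep E)]
    refine Finset.sum_congr rfl fun q _ => ?_
    rw [Matrix.conjTranspose_mul, C.conjTranspose_proj, ← Pauli.toMatrix_inv, inv_inv,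
      Matrix.mul_assoc, ← Matrix.mul_assoc C.proj, C.proj_mul_proj, ← Matrix.mul_assoc]
    rfl
  refine ⟨_, isChannel_of_kraus K hK, ?_⟩
  rintro Φ ⟨r, K', ⟨hΦ, htp⟩, hE⟩
  choose e he c hc using hE
  obtain rfl : K' = fun a => c a • (e a).toMatrix := funext hc
  -- The residual logical error after recovery. The representative is taken in `E` whenever the
  -- coset meets `E`, so `h` applies to it.
  let f : Fin r → Pauli ι := fun a => (C.cosetRep E (QuotientGroup.mk (e a)))⁻¹ * e a
  have hfN : ∀ a, f a ∈ C.N := fun a => C.cosetRep_inv_mul_mem_N E (e a)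
  have hf : ∀ a, f a ∈ M := fun a => h _ (C.cosetRep_mem (he a)) _ (he a) (hfN a)
  have hL : ∑ a, (c a • (f a).toMatrix)ᴴ * (c a • (f a).toMatrix) = 1 := by
    rw [← htp]
    exact Finset.sum_congr rfl fun a _ => by simp only [conjTranspose_mul_self_smul_toMatrix]
  refine ⟨fun ρ => ∑ a, (c a • (f a).toMatrix) * ρ * (c a • (f a).toMatrix)ᴴ,
    ⟨⟨r, _, ⟨fun ρ => rfl, hL⟩, fun a => ⟨f a, hf a, c a, rfl⟩⟩,
      fun ρ hρ => hρ.sum_kraus c f hfN hL⟩, fun ρ hρ => ?_⟩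
  -- On the code space, an error is seen only by the Kraus operator of its own syndrome, which turns
  -- it into the residual error.
  have key : ∀ a q, K q * (c a • (e a).toMatrix) * C.proj =
      if q = QuotientGroup.mk (e a) then (c a • (f a).toMatrix) * C.proj else 0 := by
    intro a q
    have e1 : K q * (c a • (e a).toMatrix) * C.proj =
        c a • (C.proj * ((C.cosetRep E q)⁻¹ * e a).toMatrix * C.proj) := by
      rw [Pauli.toMatrix_mul]
      simp only [K, Matrix.mul_smul, Matrix.smul_mul, Matrix.mul_assoc]
    rw [e1]
    split_ifs with hq
    · subst hq
      rw [← C.toMatrix_mul_proj_comm (hfN a), Matrix.mul_assoc, C.proj_mul_proj, Matrix.smul_mul]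
    · rw [C.proj_mul_toMatrix_mul_proj, smul_zero]
      intro hm
      have := QuotientGroup.eq.2 hm
      rw [C.mk_cosetRep] at this
      exact hq this
  have conj : ∀ A : Op ι, A * ρ * Aᴴ = (A * C.proj) * ρ * (A * C.proj)ᴴ := by
    intro A
    conv_lhs => rw [hρ.eq_proj_mul_mul_proj]
    rw [Matrix.conjTranspose_mul, C.conjTranspose_proj]
    simp only [Matrix.mul_assoc]
  calc ∑ q, K q * Φ ρ * (K q)ᴴ
      = ∑ q, ∑ a, (K q * (c a • (e a).toMatrix)) * ρ * (K q * (c a • (e a).toMatrix))ᴴ := by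
        refine Finset.sum_congr rfl fun q _ => ?_
        rw [hΦ, Finset.mul_sum, Finset.sum_mul]
        refine Finset.sum_congr rfl fun a _ => ?_
        rw [Matrix.conjTranspose_mul (K q)]
        simp only [Matrix.mul_assoc]
    _ = ∑ a, (c a • (f a).toMatrix) * ρ * (c a • (f a).toMatrix)ᴴ := by
        rw [Finset.sum_comm]
        refine Finset.sum_congr rfl fun a _ => ?_
        rw [Finset.sum_eq_single (QuotientGroup.mk (e a))]
        · rw [conj, key, if_pos rfl, ← conj]
        · intro q _ hq
          rw [conj, key, if_neg hq, Matrix.zero_mul, Matrix.zero_mul]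
        · intro hq
          exact absurd (Finset.mem_univ _) hq

/-- With `π e = r⁻¹ e` for a common representative `r` of the coset, `r` cancels from `(π e)⁻¹ π f`,
so the conditions hold as an identity of Pauli elements, with trivial phase. -/
theorem transmutingConditions_of_inv_mul_mem (C : StabilizerCode ι) {M E : Set (Pauli ι)}
    (h : ∀ e ∈ E, ∀ f ∈ E, e⁻¹ * f ∈ C.N → e⁻¹ * f ∈ M) : TransmutingConditions C M E := by
  refine ⟨fun e => (C.cosetRep E (QuotientGroup.mk e))⁻¹ * e,
    fun e he => h _ (C.cosetRep_mem he) _ he (C.cosetRep_inv_mul_mem_N E e),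
    fun e he f hf hef => ⟨0, fun ψ _ => ?_⟩⟩
  have : (QuotientGroup.mk e : Pauli ι ⧸ C.N) = QuotientGroup.mk f := QuotientGroup.eq.2 hef
  beta_reduce
  rw [Pauli.scalar_zero, one_mul, this]
  congr 2
  group

theorem inv_mul_mem_of_weight_le (C : StabilizerCode ι) {M : Set (Pauli ι)} {w : ℕ}
    (hw : (2 * w + 1 : ℕ∞) ≤ C.minWeightOutside M) :
    ∀ e ∈ errorsUpTo ι w, ∀ f ∈ errorsUpTo ι w, e⁻¹ * f ∈ C.N → e⁻¹ * f ∈ M := by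
  intro e he f hf hN
  by_contra hM
  have h1 : C.minWeightOutside M ≤ ((e⁻¹ * f).weight : ℕ∞) := iInf₂_le _ ⟨hN, hM⟩
  have h2 : (e⁻¹ * f).weight ≤ 2 * w := by
    have := Pauli.weight_mul_le e⁻¹ f
    rw [Pauli.weight_inv] at this
    simp only [errorsUpTo, Set.mem_ofPred_eq] at he hf
    omega
  have h3 := hw.trans h1
  norm_cast at h3
  omega

/-- For finite `d > 0` the choice `w = d - 1` gives `2w + 1 = 2d - 1`; for `d = ⊤` every `w` is
allowed. The `+ 1` on the right avoids truncated subtraction. -/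
theorem le_effectiveDistance_add_one (C : StabilizerCode ι) {M : Set (Pauli ι)} {d : ℕ∞}
    (hd : 2 * d ≤ C.minWeightOutside M) : 2 * d ≤ effectiveDistance C M + 1 := by
  have key : ∀ w : ℕ, (2 * w + 1 : ℕ∞) ≤ 2 * d → (2 * w + 1 : ℕ∞) ≤ effectiveDistance C M := by
    intro w hw
    exact le_iSup₂_of_le w
      (transmutingConditions_of_inv_mul_mem C (inv_mul_mem_of_weight_le C (hw.trans hd))) le_rfl
  induction d using ENat.recTopCoe with
  | top =>
    have : effectiveDistance C M = ⊤ := by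
      refine ENat.eq_top_iff_forall_ge.2 fun m => le_trans ?_ (key m (by simp))
      norm_cast
      omega
    rw [this]
    simp
  | coe d =>
    rcases d with _ | m
    · simp
    · have := key m (by norm_cast; omega)
      calc (2 * ((m + 1 : ℕ) : ℕ∞)) = (2 * m + 1) + 1 := by push_cast; ring
        _ ≤ _ := by gcongr

end

/-! ### Majorana vectors and the normaliser of the CSS stabiliser -/

section

variable {ι : Type} [Fintype ι] [DecidableEq ι]

theorem majorana_injective {x z t x' z' t' : ι → ZMod 2}
    (h : majorana x z t = majorana x' z' t') : x = x' ∧ z = z' ∧ t = t' := by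
  have ht : t = t' := funext fun i => by simpa [majorana] using congrFun h (i, 1)
  subst ht
  exact ⟨funext fun i => by simpa [majorana] using congrFun h (i, 0),
    funext fun i => by simpa [majorana] using congrFun h (i, 2), rfl⟩

/-- Over a nontrivial tensor factor exactly two of the four entries are nonzero; over a trivial one,
none or all four. Hence `t = 0` is optimal. -/
theorem two_mul_weight_le (g : Pauli ι) (t : ι → ZMod 2) :
    2 * g.weight ≤ (Finset.univ.filter fun q => majorana g.x g.z t q ≠ 0).card := by
  have key : ∀ a b s : ZMod 2, 2 * (if a ≠ 0 ∨ b ≠ 0 then 1 else 0) ≤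
      (if a + s ≠ 0 then 1 else 0) + (if 0 + s ≠ 0 then 1 else 0) + (if b + s ≠ 0 then 1 else 0) +
        (if a + b + s ≠ 0 then 1 else 0) := by decide
  rw [Pauli.weight, Finset.card_filter, Finset.card_filter, Fintype.sum_prod_type, Finset.mul_sum]
  refine Finset.sum_le_sum fun i _ => ?_
  rw [Fin.sum_univ_four]
  exact key (g.x i) (g.z i) (t i)

theorem weight_X_majorana (g : Pauli ι) :
    (Pauli.X (majorana g.x g.z 0)).weight = 2 * g.weight := by
  have key : ∀ a b : ZMod 2,
      (if a + 0 ≠ 0 ∨ (0 : ZMod 2) ≠ 0 then 1 else 0) +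
        (if (0 : ZMod 2) + 0 ≠ 0 ∨ (0 : ZMod 2) ≠ 0 then 1 else 0) +
        (if b + 0 ≠ 0 ∨ (0 : ZMod 2) ≠ 0 then 1 else 0) +
        (if a + b + 0 ≠ 0 ∨ (0 : ZMod 2) ≠ 0 then 1 else 0) =
      2 * (if a ≠ 0 ∨ b ≠ 0 then 1 else 0) := by decide
  rw [Pauli.weight, Pauli.weight, Finset.card_filter, Finset.card_filter, Fintype.sum_prod_type,
    Finset.mul_sum]
  refine Finset.sum_congr rfl fun i _ => ?_
  rw [Fin.sum_univ_four]
  exact key (g.x i) (g.z i)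

/-- The binary vectors that represent the Pauli elements of `M`. -/
def majoranaSupports (M : Set (Pauli ι)) : Set (ι × Fin 4 → ZMod 2) :=
  {v | ∃ g ∈ M, ∃ t, v = majorana g.x g.z t}

/-- The phase is free, so membership splits into independent conditions on the `X` and `Z` parts. -/
theorem mem_majoranaErrors {M : Set (Pauli ι)} {F : Pauli (ι × Fin 4)} :
    F ∈ majoranaErrors M ↔ F.x ∈ majoranaSupports M ∧ F.z ∈ majoranaSupports M := by
  constructor
  · rintro ⟨c, _, ⟨g, hg, t, rfl⟩, _, ⟨h, hh, s, rfl⟩, rfl⟩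
    exact ⟨⟨g, hg, t, by simp [Pauli.scalar, Pauli.X, Pauli.Z]⟩,
      ⟨h, hh, s, by simp [Pauli.scalar, Pauli.X, Pauli.Z]⟩⟩
  · rintro ⟨⟨g, hg, t, hx⟩, ⟨h, hh, s, hz⟩⟩
    exact ⟨F.phase, _, ⟨g, hg, t, rfl⟩, _, ⟨h, hh, s, rfl⟩,
      Pauli.ext (by simp [Pauli.scalar, Pauli.X, Pauli.Z])
        (by simp [Pauli.scalar, Pauli.X, Pauli.Z, hx])
        (by simp [Pauli.scalar, Pauli.X, Pauli.Z, hz])⟩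

theorem mem_of_majorana_mem_majoranaSupports {M : Set (Pauli ι)}
    (hM : ∀ g ∈ M, ∀ c, Pauli.scalar ι c * g ∈ M) {g : Pauli ι} {t : ι → ZMod 2}
    (h : majorana g.x g.z t ∈ majoranaSupports M) : g ∈ M := by
  obtain ⟨f, hf, s, e⟩ := h
  obtain ⟨hx, hz, -⟩ := majorana_injective e
  have := hM f hf (g.phase - f.phase)
  rw [Pauli.scalar_mul, ← hx, ← hz, sub_add_cancel] at this
  exact this

/-- Orthogonality to the all-ones vector of each block means even parity there. An even block is
determined by three entries: the second is `t`, and adding it to the first and third gives `x` and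
`z`. -/
theorem exists_eq_majorana_of_dotProduct_eq_zero {v : ι × Fin 4 → ZMod 2}
    (h : ∀ t, v ⬝ᵥ majorana 0 0 t = 0) : ∃ g : Pauli ι, ∃ t, v = majorana g.x g.z t := by
  refine ⟨⟨0, fun i => v (i, 0) + v (i, 1), fun i => v (i, 2) + v (i, 1)⟩, fun i => v (i, 1), ?_⟩
  have key : ∀ a b c d : ZMod 2, a + b + c + d = 0 →
      a = a + b + b ∧ c = c + b + b ∧ d = a + b + (c + b) + b := by decide
  funext ⟨i, j⟩
  have hi : v (i, 0) + v (i, 1) + v (i, 2) + v (i, 3) = 0 := by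
    have := h (Pi.single i 1)
    rw [dotProduct, Fintype.sum_prod_type, Finset.sum_eq_single i] at this
    · simpa [Fin.sum_univ_four, majorana] using this
    · intro j _ hj
      simp [Fin.sum_univ_four, majorana, hj]
    · intro hn
      exact absurd (Finset.mem_univ _) hn
  obtain ⟨h1, h2, h3⟩ := key _ _ _ _ hi
  fin_cases j
  · exact h1
  · simp [majorana]
  · exact h2
  · exact h3

namespace StabilizerCode

variable (C : StabilizerCode ι)

/-- The vectors of the identity in `D` force `v` to be a Majorana vector; pairing with the other
stabilisers is then the commutation condition for `N(S)`. -/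
theorem forall_dotProduct_majoranaCode_iff {v : ι × Fin 4 → ZMod 2} :
    (∀ u ∈ C.majoranaCode, v ⬝ᵥ u = 0) ↔ v ∈ majoranaSupports (C.N : Set (Pauli ι)) := by
  constructor
  · intro h
    obtain ⟨g, t, rfl⟩ := exists_eq_majorana_of_dotProduct_eq_zero (v := v)
      fun t => h _ ⟨1, C.S.one_mem, t, rfl⟩
    refine ⟨g, C.mem_N.2 fun s hs => Pauli.mul_comm_iff.2 ?_, t, rfl⟩
    have := h _ ⟨s, hs, 0, rfl⟩
    rw [majorana_dotProduct] at this
    rw [Pauli.symp, dotProduct_comm s.z, add_comm]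
    exact this
  · rintro ⟨g, hg, t, rfl⟩ _ ⟨s, hs, t', rfl⟩
    rw [majorana_dotProduct, add_comm, dotProduct_comm g.x]
    exact Pauli.mul_comm_iff.1 (C.mem_N.1 hg s hs)

theorem mem_toCSS_N {F : Pauli (ι × Fin 4)} :
    F ∈ C.toCSS.N ↔ F ∈ majoranaErrors (C.N : Set (Pauli ι)) := by
  rw [toCSS, mem_cssCode_N, forall_dotProduct_majoranaCode_iff, forall_dotProduct_majoranaCode_iff,
    mem_majoranaErrors]

/-- Upper bound: the pure `X` operator with `t = 0` of a lightest element of `N(S) \ M`. Lower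
bound: outside `M'` one of the two parts represents an element of `N(S) \ M`, and the weight of the
operator is at least that of each part. Closure under phases is needed because a vector determines
its Pauli element only up to phase. -/
theorem minWeightOutside_majoranaErrors {M : Set (Pauli ι)}
    (hM : ∀ g ∈ M, ∀ c, Pauli.scalar ι c * g ∈ M) :
    C.toCSS.minWeightOutside (majoranaErrors M) = 2 * C.minWeightOutside M := by
  apply le_antisymm
  · rcases Set.eq_empty_or_nonempty ((C.N : Set (Pauli ι)) \ M) with h | h
    · simp [minWeightOutside, h]
    · obtain ⟨g, hg, hmin⟩ := Set.exists_min_image _ Pauli.weight (Set.toFinite _) h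
      have h1 : C.minWeightOutside M = g.weight :=
        le_antisymm (iInf₂_le g hg) (le_iInf₂ fun f hf => Nat.cast_le.2 (hmin f hf))
      rw [h1]
      have hX : Pauli.X (majorana g.x g.z 0) ∈
          (C.toCSS.N : Set (Pauli (ι × Fin 4))) \ majoranaErrors M := by
        constructor
        · refine C.mem_toCSS_N.2 (mem_majoranaErrors.2 ⟨⟨g, hg.1, 0, rfl⟩, 1, C.N.one_mem, 0, ?_⟩)
          funext ⟨i, j⟩
          fin_cases j <;> simp [majorana, Pauli.X]
        · intro hF
          exact hg.2 (mem_of_majorana_mem_majoranaSupports hM (mem_majoranaErrors.1 hF).1)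
      refine (iInf₂_le _ hX).trans ?_
      rw [weight_X_majorana]
      push_cast
      exact le_rfl
  · refine le_iInf₂ ?_
    rintro F ⟨hF, hFM⟩
    obtain ⟨⟨g, hg, t, hx⟩, ⟨f, hf, s, hz⟩⟩ := mem_majoranaErrors.1 (C.mem_toCSS_N.1 hF)
    have hwx : 2 * g.weight ≤ F.weight := by
      refine (two_mul_weight_le g t).trans (Finset.card_le_card fun q => ?_)
      rw [← hx]
      simp +contextual
    have hwz : 2 * f.weight ≤ F.weight := by
      refine (two_mul_weight_le f s).trans (Finset.card_le_card fun q => ?_)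
      rw [← hz]
      simp +contextual
    have bound : ∀ h ∈ (C.N : Set (Pauli ι)) \ M, 2 * h.weight ≤ F.weight →
        2 * C.minWeightOutside M ≤ (F.weight : ℕ∞) := by
      intro h hh hw
      calc 2 * C.minWeightOutside M ≤ 2 * (h.weight : ℕ∞) := by
            gcongr
            exact iInf₂_le h hh
        _ ≤ F.weight := by exact_mod_cast hw
    by_cases hgM : g ∈ M
    · refine bound f ⟨hf, fun hfM => hFM (mem_majoranaErrors.2 ⟨⟨g, hgM, t, hx⟩, f, hfM, s, hz⟩)⟩ hwz
    · exact bound g ⟨hg, hgM⟩ hwx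

/-! ### Parameters of the CSS code and its admissible set -/

theorem trivialLogicals_toCSS :
    C.toCSS.trivialLogicals = majoranaErrors C.trivialLogicals := by
  have hsupp : ∀ v, v ∈ majoranaSupports C.trivialLogicals ↔ v ∈ C.majoranaCode := by
    intro v
    constructor
    · rintro ⟨_, ⟨c, s, hs, rfl⟩, t, rfl⟩
      exact ⟨s, hs, t, by rw [Pauli.scalar_mul]⟩
    · rintro ⟨s, hs, t, rfl⟩
      exact ⟨s, ⟨0, s, hs, by rw [Pauli.scalar_zero, one_mul]⟩, t, rfl⟩
  ext F
  rw [mem_majoranaErrors, hsupp, hsupp]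
  constructor
  · rintro ⟨c, s, ⟨-, hx, hz⟩, rfl⟩
    rw [Pauli.scalar_mul]
    exact ⟨hx, hz⟩
  · rintro ⟨hx, hz⟩
    exact ⟨F.phase, ⟨0, F.x, F.z⟩, ⟨rfl, hx, hz⟩, by rw [Pauli.scalar_mul, add_zero]⟩

/-- The trivial logicals of the CSS code are the Majorana errors of those of `C`, so this is an
instance of the doubling of minimum weights. -/
theorem distance_toCSS : C.toCSS.distance = 2 * C.distance := by
  rw [distance, trivialLogicals_toCSS, minWeightOutside_majoranaErrors, distance]
  rintro _ ⟨c, s, hs, rfl⟩ d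
  exact ⟨d + c, s, hs, by rw [← mul_assoc, Pauli.scalar_mul_scalar]⟩

theorem card_majoranaCode :
    Nat.card C.majoranaCode = Nat.card C.S * 2 ^ Fintype.card ι := by
  let φ : C.S × (ι → ZMod 2) → C.majoranaCode :=
    fun p => ⟨majorana (p.1 : Pauli ι).x (p.1 : Pauli ι).z p.2, p.1, p.1.2, p.2, rfl⟩
  -- A Majorana vector forgets the phase, but a stabiliser is determined by its `X` and `Z` parts.
  have hφ : Function.Bijective φ := by
    constructor
    · rintro ⟨g, t⟩ ⟨h, s⟩ e
      obtain ⟨hx, hz, ht⟩ := majorana_injective (congrArg Subtype.val e)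
      exact Prod.ext (Subtype.ext (C.eq_of_x_eq_of_z_eq g.2 h.2 hx hz)) ht
    · rintro ⟨_, g, hg, t, rfl⟩
      exact ⟨(⟨g, hg⟩, t), rfl⟩
  rw [← Nat.card_congr (Equiv.ofBijective φ hφ), Nat.card_prod]
  simp

theorem finrank_majoranaCode {k : ℕ} (hC : C.EncodesQubits k) :
    Module.finrank (ZMod 2) C.majoranaCode + k = 2 * Fintype.card ι := by
  have h1 := Module.natCard_eq_pow_finrank (K := ZMod 2) (V := C.majoranaCode)
  rw [card_majoranaCode, hC.2, ← pow_add, Nat.card_zmod] at h1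
  have h2 := Nat.pow_right_injective le_rfl h1
  have := hC.1
  omega

theorem encodesQubits_toCSS {k : ℕ} (hC : C.EncodesQubits k) : C.toCSS.EncodesQubits (2 * k) := by
  have hk := hC.1
  refine ⟨by simp; omega, ?_⟩
  let φ : C.toCSS.S ≃ C.majoranaCode × C.majoranaCode :=
    { toFun := fun g => (⟨(g : Pauli _).x, g.2.2.1⟩, ⟨(g : Pauli _).z, g.2.2.2⟩)
      invFun := fun p => ⟨⟨0, p.1, p.2⟩, rfl, p.1.2, p.2.2⟩
      left_inv := fun g => Subtype.ext (Pauli.ext g.2.1.symm rfl rfl)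
      right_inv := fun p => rfl }
  rw [Nat.card_congr φ, Nat.card_prod, card_majoranaCode, hC.2, ← pow_add, ← pow_add]
  congr 1
  simp
  omega

theorem mul_mem_majoranaErrors {M : Set (Pauli ι)} (hS : ∀ g ∈ M, ∀ s ∈ C.S, g * s ∈ M)
    {F G : Pauli (ι × Fin 4)} (hF : F ∈ majoranaErrors M) (hG : G ∈ C.toCSS.S) :
    F * G ∈ majoranaErrors M := by
  obtain ⟨⟨g, hg, t, hx⟩, ⟨f, hf, s, hz⟩⟩ := mem_majoranaErrors.1 hF
  obtain ⟨-, ⟨g', hg', t', hx'⟩, ⟨f', hf', s', hz'⟩⟩ := hG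
  refine mem_majoranaErrors.2 ⟨⟨g * g', hS g hg g' hg', t + t', ?_⟩,
    ⟨f * f', hS f hf f' hf', s + s', ?_⟩⟩
  · rw [Pauli.mul_x, hx, hx', majorana_add]; rfl
  · rw [Pauli.mul_z, hz, hz', majorana_add]; rfl

theorem majoranaErrors_subset_N {M : Set (Pauli ι)} (hM : M ⊆ C.N) :
    majoranaErrors M ⊆ C.toCSS.N := by
  intro F hF
  obtain ⟨⟨g, hg, t, hx⟩, ⟨f, hf, s, hz⟩⟩ := mem_majoranaErrors.1 hF
  exact C.mem_toCSS_N.2 (mem_majoranaErrors.2 ⟨⟨g, hM hg, t, hx⟩, f, hM hf, s, hz⟩)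

theorem exists_lift_eq_majoranaErrors {k : ℕ} (hC : C.EncodesQubits k) {M : Set (Pauli ι)}
    (hN : M ⊆ C.N) (h1 : 1 ∈ M) (hS : ∀ g ∈ M, ∀ s ∈ C.S, g * s ∈ M) :
    ∃ (A' : Pauli (Fin (2 * k)) ≃* C.toCSS.LogicalGroup) (Mbar' : Set (Pauli (Fin (2 * k)))),
      1 ∈ Mbar' ∧ C.toCSS.lift A' Mbar' = majoranaErrors M := by
  have hk := C.finrank_majoranaCode hC
  -- Here `dim D = 2n - k`, so `2 dim D + 2k = 4n`.
  obtain ⟨A'⟩ := exists_logicalGroup_equiv C.majoranaCode C.majoranaCode_orthogonal (2 * k)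
    (by simp; omega)
  have hone : (0 : ι × Fin 4 → ZMod 2) ∈ majoranaSupports M := by
    refine ⟨1, h1, 0, ?_⟩
    funext ⟨i, j⟩
    fin_cases j <;> simp [majorana]
  refine ⟨A', C.toCSS.exists_lift_eq A' _ (C.majoranaErrors_subset_N hN)
    (mem_majoranaErrors.2 ⟨hone, hone⟩) (fun F hF c => ?_)
    fun F hF G hG => C.mul_mem_majoranaErrors hS hF hG⟩
  have h := mem_majoranaErrors.1 hF
  rw [Pauli.scalar_mul]
  exact mem_majoranaErrors.2 h

end StabilizerCode

end

end QET

end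

theorem mainTheorem11 (n k : ℕ) (C : QET.StabilizerCode (Fin n)) (hC : C.EncodesQubits k)
    (A : QET.Pauli (Fin k) ≃* C.LogicalGroup) (Mbar : Set (QET.Pauli (Fin k)))
    (hM : 1 ∈ Mbar) :
    -- `CSS(C)` is a weakly self-dual CSS code with parameters `[4n, 2k, 2d]`
    (QET.IsWeaklySelfDualCSS C.toCSS ∧
      Fintype.card (Fin n × Fin 4) = 4 * n ∧
      C.toCSS.EncodesQubits (2 * k) ∧
      C.toCSS.distance = 2 * C.distance) ∧
    -- `M'` is the lift of a set of logical Pauli errors on `2k` qubits containing the identity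
    (∃ (A' : QET.Pauli (Fin (2 * k)) ≃* C.toCSS.LogicalGroup)
      (Mbar' : Set (QET.Pauli (Fin (2 * k)))),
      1 ∈ Mbar' ∧ C.toCSS.lift A' Mbar' = QET.majoranaErrors (C.lift A Mbar)) ∧
    -- the bound doubles
    C.toCSS.minWeightOutside (QET.majoranaErrors (C.lift A Mbar))
      = 2 * C.minWeightOutside (C.lift A Mbar) ∧
    -- the effective distance `2w + 1` is at least `2 d - 1`, where `d` is the bound for `C`
    2 * C.minWeightOutside (C.lift A Mbar)
      ≤ QET.effectiveDistance C.toCSS (QET.majoranaErrors (C.lift A Mbar)) + 1 ∧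
    -- a recovery channel transmutes all errors of weight at most `⌊(2 d - 1) / 2⌋`
    (∀ w : ℕ, (2 * w + 1 : ℕ∞) ≤ 2 * C.minWeightOutside (C.lift A Mbar) →
      QET.IsQETCode C.toCSS (QET.majoranaErrors (C.lift A Mbar))
        (QET.errorsUpTo (Fin n × Fin 4) w)) := by
  have hscalar : ∀ g ∈ C.lift A Mbar, ∀ c, QET.Pauli.scalar (Fin n) c * g ∈ C.lift A Mbar :=
    fun g hg c => C.scalar_mul_mem_lift hg c
  have hmin := C.minWeightOutside_majoranaErrors hscalar
  refine ⟨⟨⟨_, _, rfl⟩, by simp [mul_comm], C.encodesQubits_toCSS hC, C.distance_toCSS⟩,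
    C.exists_lift_eq_majoranaErrors hC (C.lift_subset_N A Mbar) (C.one_mem_lift hM)
      (fun g hg s hs => C.mul_mem_lift hg hs),
    hmin, QET.le_effectiveDistance_add_one _ hmin.ge, fun w hw => ?_⟩
  exact QET.isQETCode_of_inv_mul_mem _ (QET.inv_mul_mem_of_weight_le _ (hw.trans hmin.ge))
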